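/- Let $\mathcal V=(\mathcal V,\otimes,k)$ be a commutative unital quantale: a complete lattice with a commutative monoid structure whose tensor $\otimes$ distributes over arbitrary joins. Assume that the lattice $\mathcal V$ is completely distributive, that $k=\top$ ($k$ is terminal), and that $k$ is approximated: the set $\{u\in\mathcal V\mid u\ll k\}$ is directed (in particular non-empty) with join $k$, where $u\ll v$ means that every down-set $A$ with $v\le\bigvee A$ contains $u$. Let $U$ denote the ultrafilter monad on sets, with unit $e$ and multiplication $m$, and let $$\xi:U\mathcal V\to\mathcal V,\qquad \xi(\mathfrak v)=\bigwedge_{A\in\mathfrak v}\bigvee_{u\in A}u .$$ Assume that $\mathbb U=(U,\mathcal V,\xi)$ is a strict ultrafilter theory, that is: $\xi\cdot e_{\mathcal V}=1$ and $\xi\cdot U\xi=\xi\cdot m_{\mathcal V}$; $\xi(U\pi_1(\mathfrak w))\otimes\xi(U\pi_2(\mathfrak w))=\xi(U{\otimes}(\mathfrak w))$ for all $\mathfrak w\in U(\mathcal V\times\mathcal V)$; and the maps $\mathcal V^X\to\mathcal V^{UX}$, $\varphi\mapsto\xi\cdot U\varphi$, are natural in $X$, where a map $f:X\to Y$ acts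 by $\varphi\mapsto\bigl(y\mapsto\bigvee_{f(x)=y}\varphi(x)\bigr)$. A $\mathcal V$-category $(X,a_0)$ is a set $X$ with $a_0:X\times X\to\mathcal V$ such that $k\le a_0(x,x)$ and $a_0(x,y)\otimes a_0(y,z)\le a_0(x,z)$; a $\mathcal V$-functor $(Y,b)\to(X,a_0)$ is a map $f:Y\to X$ with $b(y,y')\le a_0(f(y),f(y'))$. Maps $r:X\times Y\to\mathcal V$ are $\mathcal V$-relations, composed by $(s\cdot r)(x,z)=\bigvee_{y}r(x,y)\otimes s(y,z)$. A distributor from $(Y,b)$ to $(X,a_0)$ is a $\mathcal V$-relation $\varphi:Y\times X\to\mathcal V$ with $\varphi\cdot b\le\varphi$ and $a_0\cdot\varphi\le\varphi$; an adjunction $\varphi\dashv\psi$, with $\psi$ a distributor from $(X,a_0)$ to $(Y,b)$, means $b\le\psi\cdot\varphi$ and $\varphi\cdot\psi\le a_0$. The $\mathcal V$-category $(X,a_0)$ is Cauchy complete if for every $\mathcal V$-category $(Y,b)$ and every adjunction $\varphi\dashv\psi$ of distributors with $\varphi$ from $Y$ to $X$ there is a $\mathcal V$-functor $f:Y\to X$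 with $\varphi(y,x)=a_0(f(y),x)$ and $\psi(x,y)=a_0(x,f(y))$ for all $x,y$. 1. Let $(X,a_0,\alpha)$ be an Eilenberg--Moore algebra for the ultrafilter monad on $\mathcal V$-categories, that is: $(X,a_0)$ is a $\mathcal V$-category and $\alpha:UX\to X$ satisfies $\alpha\cdot e_X=1_X$, $\alpha\cdot U\alpha=\alpha\cdot m_X$ and $U_\xi a_0(\mathfrak x,\mathfrak y)\le a_0(\alpha(\mathfrak x),\alpha(\mathfrak y))$ for all $\mathfrak x,\mathfrak y\in UX$, where $U_\xi a_0(\mathfrak x,\mathfrak y)=\bigvee\{\xi(Ua_0(\mathfrak w))\mid\mathfrak w\in U(X\times X),\,U\pi_1(\mathfrak w)=\mathfrak x,\,U\pi_2(\mathfrak w)=\mathfrak y\}$. Then the $\mathcal V$-category $(X,a_0)$ is Cauchy complete. 2. In particular, every compact separated $\mathcal V$-category is Cauchy complete. Here $(X,a_0)$ is separated if $k\le a_0(x,y)$ and $k\le a_0(y,x)$ imply $x=y$, and compact if $X$ is compact in the topology whose closed sets are the $M\subseteq X$ with $\overline M=M$, where $x\in\overline M$ means that the distributors $i^*\cdot x_*=a_0(x,-)|_M$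 from $(1,k)$ to $M$ and $x^*\cdot i_*=a_0(-,x)|_M$ from $M$ to $(1,k)$ form an adjunction $i^*\cdot x_*\dashv x^*\cdot i_*$ (equivalently $k\le\bigvee_{z\in M}a_0(x,z)\otimes a_0(z,x)$); here $i:M\hookrightarrow X$ is the inclusion. -/

import Mathlib

/-! A (commutative, unital) quantale is a complete lattice `V` with a commutative monoid structure
whose multiplication (the tensor) distributes over arbitrary joins: `[CompleteLattice V]`,
`[CommMonoid V]`, `[IsQuantale V]`.  The neutral element `k` is `1`. -/

namespace VQ

section Quantale

variable {V : Type*} [CompleteLattice V]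

/-- `x` is totally below `y`: every down set whose join lies above `y` contains `x`. -/
def TotallyBelow (x y : V) : Prop :=
  ∀ A : LowerSet V, y ≤ sSup (A : Set V) → x ∈ A

variable (V) in
/-- The neutral element is approximated: the set of elements totally below it is directed
(in particular non-empty), and its join is the neutral element. -/
def IsApproximated [One V] : Prop :=
  {u : V | TotallyBelow u 1}.Nonempty ∧
  DirectedOn (· ≤ ·) {u : V | TotallyBelow u 1} ∧
  sSup {u : V | TotallyBelow u 1} = 1

variable (V) in
/-- The neutral element is `∨`-irreducible. -/
def IsVeeIrreducible [One V] : Prop :=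
  ⊥ < (1 : V) ∧ ∀ u v : V, 1 ≤ u ⊔ v → 1 ≤ u ∨ 1 ≤ v

theorem IsApproximated.isVeeIrreducible [One V] (h : IsApproximated V) : IsVeeIrreducible V := by
  obtain ⟨⟨w, hw⟩, hd, hs⟩ := h
  refine ⟨bot_lt_iff_ne_bot.2 fun h0 => ?_, fun u v huv => ?_⟩
  · have := hw ⊥ (by simp [h0])
    simp at this
  · have key : ∀ x : V, TotallyBelow x 1 → x ≤ u ∨ x ≤ v := by
      intro x hx
      have hx' := hx (LowerSet.Iic u ⊔ LowerSet.Iic v)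
        (huv.trans (sup_le (le_sSup (Or.inl le_rfl)) (le_sSup (Or.inr le_rfl))))
      simpa using hx'
    by_contra hcon
    rw [not_or] at hcon
    obtain ⟨hu, hv⟩ := hcon
    rw [← hs, sSup_le_iff] at hu hv
    push Not at hu hv
    obtain ⟨x, hx, hxu⟩ := hu
    obtain ⟨y, hy, hyv⟩ := hv
    obtain ⟨z, hz, hxz, hyz⟩ := hd x hx y hy
    rcases key z hz with h | h
    · exact hxu (hxz.trans h)
    · exact hyv (hyz.trans h)

end Quantale

section UltrafilterTheory

variable {V : Type*} [CompleteLattice V]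

/-- The map `UV → V`, `𝔳 ↦ ⋀_{A ∈ 𝔳} ⋁_{u ∈ A} u`. -/
def canonicalXi (𝔳 : Ultrafilter V) : V := ⨅ A ∈ 𝔳, ⨆ u ∈ A, u

/-- Eilenberg–Moore algebra for the ultrafilter monad on sets, with unit
`x ↦ pure x` (principal ultrafilters), multiplication `𝔛 ↦ 𝔛.bind id`
(so `A ∈ 𝔛.bind id ↔ {𝔵 | A ∈ 𝔵} ∈ 𝔛`); equivalently, the convergence of a compact Hausdorff
topology. -/
structure IsUltrafilterAlgebra {X : Type*} (α : Ultrafilter X → X) : Prop where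
  unit : ∀ x : X, α (pure x) = x
  assoc : ∀ 𝔛 : Ultrafilter (Ultrafilter X), α (𝔛.map α) = α (𝔛.bind id)

/-- The covariant `V`-powerset functor on morphisms:
`(P_V f)(φ)(y) = ⋁ {φ x | f x = y}`. -/
def pushforward {X Y : Type*} (f : X → Y) (φ : X → V) (y : Y) : V :=
  ⨆ x ∈ f ⁻¹' {y}, φ x

/-- `(𝕌, V, ξ)` is an ultrafilter theory: `ξ` is an algebra structure for the ultrafilter monad,
the tensor is laxly continuous, and `ξ` is compatible with suprema, i.e. the maps
`V^X → V^{UX}`, `φ ↦ ξ · Uφ`, form a natural transformation `P_V → P_V U`. -/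
structure IsUltrafilterTheory.{u} {V : Type u} [CompleteLattice V] [CommMonoid V] [IsQuantale V]
    (ξ : Ultrafilter V → V) : Prop where
  algebra : IsUltrafilterAlgebra ξ
  lax_tensor : ∀ 𝔴 : Ultrafilter (V × V),
    ξ (𝔴.map Prod.fst) * ξ (𝔴.map Prod.snd) ≤ ξ (𝔴.map fun p => p.1 * p.2)
  sup_compat : ∀ (X Y : Type u) (f : X → Y) (φ : X → V) (𝔶 : Ultrafilter Y),
    pushforward (Ultrafilter.map f) (fun 𝔵 : Ultrafilter X => ξ (𝔵.map φ)) 𝔶 =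
      ξ (𝔶.map (pushforward f φ))

/-- A strict ultrafilter theory: the tensor is even continuous. -/
structure IsStrictUltrafilterTheory {V : Type*} [CompleteLattice V] [CommMonoid V] [IsQuantale V]
    (ξ : Ultrafilter V → V) : Prop extends IsUltrafilterTheory ξ where
  tensor : ∀ 𝔴 : Ultrafilter (V × V),
    ξ (𝔴.map Prod.fst) * ξ (𝔴.map Prod.snd) = ξ (𝔴.map fun p => p.1 * p.2)

end UltrafilterTheory

/-- A `V`-relation from `X` to `Y`. -/
abbrev VRel (V X Y : Type*) := X → Y → V

section Rel

variable {V : Type*} [CompleteLattice V]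

/-- Composition `s · r` of `V`-relations. -/
def VRel.comp [Mul V] {X Y Z : Type*} (s : VRel V Y Z) (r : VRel V X Y) : VRel V X Z :=
  fun x z => ⨆ y, r x y * s y z

/-- The extension `U_ξ r` of a `V`-relation `r` to ultrafilters. -/
def ultraExt (ξ : Ultrafilter V → V) {X Y : Type*} (r : VRel V X Y) :
    VRel V (Ultrafilter X) (Ultrafilter Y) :=
  fun 𝔵 𝔶 => sSup {v : V | ∃ 𝔴 : Ultrafilter (X × Y),
    𝔴.map Prod.fst = 𝔵 ∧ 𝔴.map Prod.snd = 𝔶 ∧ v = ξ (𝔴.map fun p => r p.1 p.2)}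

/-- The inequality `f · a ≤ b · f` (in pointwise form) that makes `f : (X, a) → (Y, b)`
a `V`-functor. -/
def IsVFunctor {X Y : Type*} (a : VRel V X X) (b : VRel V Y Y) (f : X → Y) : Prop :=
  ∀ x x' : X, a x x' ≤ b (f x) (f x')

end Rel

/-- A `V`-category structure on the set `X`. -/
structure VCat (V : Type*) [CompleteLattice V] [CommMonoid V] (X : Type*) where
  /-- The `V`-relation of the `V`-category. -/
  hom : VRel V X X
  one_le_hom : ∀ x, 1 ≤ hom x x
  hom_mul_hom_le : ∀ x y z, hom x y * hom y z ≤ hom x z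

section Cat

variable {V : Type*} [CompleteLattice V] [CommMonoid V] {X Y : Type*}

/-- The `V`-category `G = (1, k)`. -/
def unitCat : VCat V Unit where
  hom _ _ := 1
  one_le_hom _ := le_rfl
  hom_mul_hom_le _ _ _ := (one_mul _).le

/-- The subset `M` with the structure inherited from `X`. -/
def VCat.restrict (A : VCat V X) (M : Set X) : VCat V M where
  hom x y := A.hom x y
  one_le_hom x := A.one_le_hom x
  hom_mul_hom_le x y z := A.hom_mul_hom_le x y z

/-- Separated `V`-categories. -/
def VCat.IsSeparated (A : VCat V X) : Prop :=
  ∀ x y : X, 1 ≤ A.hom x y → 1 ≤ A.hom y x → x = y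

/-- `V`-distributors `φ` from `(X, a)` to `(Y, b)`. -/
structure IsDistributor (A : VCat V X) (B : VCat V Y) (φ : VRel V X Y) : Prop where
  right_action : VRel.comp φ A.hom ≤ φ
  left_action : VRel.comp B.hom φ ≤ φ

/-- `φ ⊣ ψ` for `V`-distributors `φ` from `(X, a)` to `(Y, b)` and `ψ` from `(Y, b)` to `(X, a)`;
the identity distributors are `a` and `b`. -/
structure IsDistAdjunction (A : VCat V X) (B : VCat V Y) (φ : VRel V X Y) (ψ : VRel V Y X) :
    Prop where
  left_dist : IsDistributor A B φ
  right_dist : IsDistributor B A ψ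
  unit : A.hom ≤ VRel.comp ψ φ
  counit : VRel.comp φ ψ ≤ B.hom

/-- The distributor `f_*`, for `f` with values in the `V`-category `B`. -/
def VCat.lowerStar (B : VCat V Y) (f : X → Y) : VRel V X Y := fun x y => B.hom (f x) y

/-- The distributor `f^*`, for `f` with values in the `V`-category `B`. -/
def VCat.upperStar (B : VCat V Y) (f : X → Y) : VRel V Y X := fun y x => B.hom y (f x)

/-- Cauchy complete `V`-categories: every adjunction of `V`-distributors `φ ⊣ ψ`, with `φ` from
some `V`-category `Y` to `X`, is of the form `f_* ⊣ f^*` for some `V`-functor `f : Y → X`. -/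
def VCat.IsCauchyComplete.{w, u, v} {V : Type u} [CompleteLattice V] [CommMonoid V] {X : Type v}
    (A : VCat V X) : Prop :=
  ∀ (Y : Type w) (B : VCat V Y) (φ : VRel V Y X) (ψ : VRel V X Y),
    IsDistAdjunction B A φ ψ →
      ∃ f : Y → X, IsVFunctor B.hom A.hom f ∧ φ = A.lowerStar f ∧ ψ = A.upperStar f

/-- The L-closure of `M`: the points `x` such that `i^* · x_* ⊣ x^* · i_*`, where
`i : M → X` is the inclusion and `x : G → X`. -/
def VCat.lClosure (A : VCat V X) (M : Set X) : Set X :=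
  {x : X | IsDistAdjunction unitCat (A.restrict M)
    (VRel.comp (A.upperStar ((↑) : M → X)) (A.lowerStar fun _ : Unit => x))
    (VRel.comp (A.upperStar fun _ : Unit => x) (A.lowerStar ((↑) : M → X)))}

variable [IsQuantale V]

theorem VCat.comp_star (A : VCat V X) {Z W : Type*} (f : Z → X) (g : W → X) :
    VRel.comp (A.upperStar g) (A.lowerStar f) = fun z w => A.hom (f z) (g w) := by
  funext z w
  apply le_antisymm
  · exact iSup_le fun y => A.hom_mul_hom_le _ _ _
  · refine le_trans ?_ (le_iSup (fun y => A.lowerStar f z y * A.upperStar g y w) (f z))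
    exact le_trans (one_mul _).ge (mul_le_mul_left (A.one_le_hom (f z)) _)

theorem VCat.mem_lClosure (A : VCat V X) (M : Set X) (x : X) :
    x ∈ A.lClosure M ↔ 1 ≤ ⨆ z : M, A.hom x z * A.hom z x := by
  have h : x ∈ A.lClosure M ↔ IsDistAdjunction unitCat (A.restrict M)
      (fun (_ : Unit) (z : M) => A.hom x z) (fun (z : M) (_ : Unit) => A.hom z x) := by
    simp only [VCat.lClosure, VCat.comp_star, Set.mem_ofPred_eq]
  rw [h]
  constructor
  · exact fun h => h.unit () ()
  · intro h1
    refine ⟨⟨?_, ?_⟩, ⟨?_, ?_⟩, ?_, ?_⟩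
    · exact fun _ z => iSup_le fun _ => (one_mul _).le
    · exact fun _ z => iSup_le fun y => A.hom_mul_hom_le _ _ _
    · exact fun z _ => iSup_le fun y => A.hom_mul_hom_le _ _ _
    · exact fun z _ => iSup_le fun _ => (mul_one _).le
    · exact fun _ _ => h1
    · exact fun z z' => iSup_le fun _ => A.hom_mul_hom_le _ _ _

theorem VCat.subset_lClosure (A : VCat V X) (M : Set X) : M ⊆ A.lClosure M := by
  intro x hx
  rw [A.mem_lClosure]
  refine le_trans ?_ (le_iSup (fun z : M => A.hom x z * A.hom z x) ⟨x, hx⟩)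
  calc (1 : V) = 1 * 1 := (one_mul 1).symm
    _ ≤ _ := mul_le_mul' (A.one_le_hom x) (A.one_le_hom x)

theorem VCat.lClosure_mono (A : VCat V X) {M N : Set X} (h : M ⊆ N) :
    A.lClosure M ⊆ A.lClosure N := by
  intro x hx
  rw [A.mem_lClosure] at hx ⊢
  exact hx.trans (iSup_le fun z =>
    le_iSup (fun z : N => A.hom x z * A.hom z x) ⟨z, h z.2⟩)

/-- The topology of the L-closure, available when `k` is `∨`-irreducible: a set is closed if and
only if it equals its L-closure. -/
@[reducible]
def VCat.lTopology (hV : IsVeeIrreducible V) (A : VCat V X) : TopologicalSpace X :=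
  TopologicalSpace.ofClosed {M : Set X | A.lClosure M = M}
    (by
      refine Set.eq_empty_of_forall_notMem fun x hx => ?_
      rw [A.mem_lClosure] at hx
      simp only [iSup_of_empty] at hx
      exact hV.1.not_ge hx)
    (by
      intro S hS
      refine Set.Subset.antisymm (fun x hx M hM => ?_) (A.subset_lClosure _)
      have h : A.lClosure M = M := hS hM
      rw [← h]
      exact A.lClosure_mono (Set.sInter_subset_of_mem hM) hx)
    (by
      intro M hM N hN
      refine Set.Subset.antisymm (fun x hx => ?_) (A.subset_lClosure _)
      rw [A.mem_lClosure] at hx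
      have h := hV.2 (⨆ z : M, A.hom x z * A.hom z x) (⨆ z : N, A.hom x z * A.hom z x)
        (hx.trans (iSup_le fun z => z.2.elim
          (fun hz => le_sup_of_le_left
            (le_iSup (fun z : M => A.hom x z * A.hom z x) ⟨z, hz⟩))
          (fun hz => le_sup_of_le_right
            (le_iSup (fun z : N => A.hom x z * A.hom z x) ⟨z, hz⟩))))
      rw [← A.mem_lClosure, ← A.mem_lClosure] at h
      rcases h with h | h
      · exact Or.inl (Eq.subset hM h)
      · exact Or.inr (Eq.subset hN h))

/-- Compact `V`-categories: the topology of the L-closure is compact (no Hausdorff condition). -/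
def VCat.IsCompact (hV : IsVeeIrreducible V) (A : VCat V X) : Prop :=
  @CompactSpace X (A.lTopology hV)

end Cat

/-- A `V`-categorical compact Hausdorff space on the set `X`, that is, an Eilenberg–Moore algebra
`(X, a₀, α)` for the ultrafilter monad on `V`-categories, which sends `(X, a₀)` to
`(UX, U_ξ a₀)`: a `V`-category `(X, a₀)` with an algebra structure `α` for the
ultrafilter monad on sets such that `α : (UX, U_ξ a₀) → (X, a₀)` is a `V`-functor. -/
structure VCompHaus {V : Type*} [CompleteLattice V] [CommMonoid V] (ξ : Ultrafilter V → V)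
    (X : Type*) where
  /-- The underlying `V`-category `(X, a₀)`. -/
  toVCat : VCat V X
  /-- The convergence of ultrafilters. -/
  conv : Ultrafilter X → X
  isAlgebra : IsUltrafilterAlgebra conv
  isVFunctor : IsVFunctor (ultraExt ξ toVCat.hom) toVCat.hom conv

end VQ

universe u v w

namespace VQ

variable {V : Type*} [CompleteLattice V] {X : Type*}

/-! An adjunction into `X` splits into Cauchy pairs `φ ⊣ ψ`, one for each point of `Y`, and a pair
is represented by `x` once `k ≤ φ x` and `k ≤ ψ x`. The unit inequality only gives `k ≤ ⋁ φ x ⊗ ψ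
x`. Since `k` is approximated, the sets `{x | u ≤ φ x ⊗ ψ x}` with `u ≪ k` are non-empty and
directed, so some ultrafilter contains them all; since `k = ⊤`, both `φ` and `ψ` tend to `k` along
it. In an algebra, its limit represents the pair: functoriality of the convergence bounds `ψ` and
`φ` by the homs into and out of the limit, and the unit inequality concludes. In a compact
`V`-category, a cluster point suffices, because it lies in the L-closure of each of those sets. -/

theorem le_ultraExt_pure_left (ξ : Ultrafilter V → V) (r : VRel V X X) (x : X)
    (𝔵 : Ultrafilter X) : ξ (𝔵.map (r x)) ≤ ultraExt ξ r (pure x) 𝔵 := by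
  -- The image of `𝔵` on the slice `{x} × X` has projections `pure x` and `𝔵`.
  refine le_sSup ⟨𝔵.map fun z => (x, z), ?_, ?_, ?_⟩
  · rw [Ultrafilter.map_map]
    exact Ultrafilter.coe_injective (Filter.map_const (f := (𝔵 : Filter X)) (c := x))
  · rw [Ultrafilter.map_map]
    exact Ultrafilter.map_id _
  · rw [Ultrafilter.map_map]
    rfl

theorem le_ultraExt_pure_right (ξ : Ultrafilter V → V) (r : VRel V X X) (x : X)
    (𝔵 : Ultrafilter X) : ξ (𝔵.map fun z => r z x) ≤ ultraExt ξ r 𝔵 (pure x) := by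
  refine le_sSup ⟨𝔵.map fun z => (z, x), ?_, ?_, ?_⟩
  · rw [Ultrafilter.map_map]
    exact Ultrafilter.map_id _
  · rw [Ultrafilter.map_map]
    exact Ultrafilter.coe_injective (Filter.map_const (f := (𝔵 : Filter X)) (c := x))
  · rw [Ultrafilter.map_map]
    rfl

/-! ### Reduction of Cauchy completeness to pairs and representing points -/

variable [CommMonoid V]

/-- A pair `φ ⊣ ψ` of adjoint distributors between the one-point `V`-category and `A`, in
pointwise form. -/
structure IsCauchyPair (A : VCat V X) (φ ψ : X → V) : Prop where
  mul_hom_le : ∀ x y, φ x * A.hom x y ≤ φ y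
  hom_mul_le : ∀ x y, A.hom x y * ψ y ≤ ψ x
  one_le_iSup : 1 ≤ ⨆ x, φ x * ψ x
  mul_le_hom : ∀ x y, ψ x * φ y ≤ A.hom x y

theorem IsDistAdjunction.isCauchyPair {Y : Type*} {A : VCat V X} {B : VCat V Y}
    {φ : VRel V Y X} {ψ : VRel V X Y} (h : IsDistAdjunction B A φ ψ) (y : Y) :
    IsCauchyPair A (φ y) (fun x => ψ x y) where
  mul_hom_le x x' := (le_iSup (fun x => φ y x * A.hom x x') x).trans (h.left_dist.left_action y x')
  hom_mul_le x x' :=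
    (le_iSup (fun x' => A.hom x x' * ψ x' y) x').trans (h.right_dist.right_action x y)
  one_le_iSup := (B.one_le_hom y).trans (h.unit y y)
  mul_le_hom x x' := (le_iSup (fun y => ψ x y * φ y x') y).trans (h.counit x x')

variable [IsQuantale V]

namespace IsCauchyPair

variable {A : VCat V X} {φ ψ : X → V}

theorem left_eq_hom (h : IsCauchyPair A φ ψ) {x : X} (hφ : 1 ≤ φ x) (hψ : 1 ≤ ψ x) (y : X) :
    φ y = A.hom x y :=
  le_antisymm
    (calc φ y = 1 * φ y := (one_mul _).symm
      _ ≤ ψ x * φ y := mul_le_mul' hψ le_rfl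
      _ ≤ A.hom x y := h.mul_le_hom x y)
    (calc A.hom x y = 1 * A.hom x y := (one_mul _).symm
      _ ≤ φ x * A.hom x y := mul_le_mul' hφ le_rfl
      _ ≤ φ y := h.mul_hom_le x y)

theorem right_eq_hom (h : IsCauchyPair A φ ψ) {x : X} (hφ : 1 ≤ φ x) (hψ : 1 ≤ ψ x) (y : X) :
    ψ y = A.hom y x :=
  le_antisymm
    (calc ψ y = ψ y * 1 := (mul_one _).symm
      _ ≤ ψ y * φ x := mul_le_mul' le_rfl hφ
      _ ≤ A.hom y x := h.mul_le_hom y x)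
    (calc A.hom y x = A.hom y x * 1 := (mul_one _).symm
      _ ≤ A.hom y x * ψ x := mul_le_mul' le_rfl hψ
      _ ≤ ψ y := h.hom_mul_le y x)

end IsCauchyPair

/-- A `V`-category is Cauchy complete as soon as each Cauchy pair is represented by a point. -/
theorem VCat.isCauchyComplete_of_isCauchyPair (A : VCat V X)
    (H : ∀ φ ψ : X → V, IsCauchyPair A φ ψ → ∃ x, 1 ≤ φ x ∧ 1 ≤ ψ x) : A.IsCauchyComplete := by
  intro Y B φ ψ h
  choose f hφ hψ using fun y => H _ _ (h.isCauchyPair y)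
  have hl : φ = A.lowerStar f := by
    funext y x
    exact (h.isCauchyPair y).left_eq_hom (hφ y) (hψ y) x
  have hr : ψ = A.upperStar f := by
    funext x y
    exact (h.isCauchyPair y).right_eq_hom (hφ y) (hψ y) x
  refine ⟨f, fun y y' => ?_, hl, hr⟩
  calc B.hom y y' = B.hom y y' * 1 := (mul_one _).symm
    -- Functoriality of `f` is the action of `B` on `φ`, tested at the representing point of `y'`.
    _ ≤ B.hom y y' * φ y' (f y') := mul_le_mul' le_rfl (hφ y')
    _ ≤ φ y (f y') := (le_iSup (fun z => B.hom y z * φ z (f y')) y').trans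
        (h.left_dist.right_action y (f y'))
    _ = A.hom (f y) (f y') := congrFun (congrFun hl y) (f y')

/-! ### Ultrafilters tending to `k`, and their limits in algebras -/

theorem TotallyBelow.exists_le_of_le_iSup {W : Type*} [CompleteLattice W] {ι : Sort*} {u v : W}
    (h : TotallyBelow u v) {g : ι → W} (hg : v ≤ ⨆ i, g i) : ∃ i, u ≤ g i :=
  -- The down-set generated by the values of `g`.
  h ⟨{w | ∃ i, w ≤ g i}, fun _ _ hba ⟨i, hi⟩ => ⟨i, hba.trans hi⟩⟩
    (hg.trans (iSup_le fun i => le_sSup ⟨i, le_rfl⟩))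

/-- If the neutral element is approximated, then there is an ultrafilter along which `g` tends to
the neutral element from below, for each family `g` with `1 ≤ ⨆ x, g x`. -/
theorem IsApproximated.exists_ultrafilter {W : Type*} [CompleteLattice W] [One W]
    (happ : IsApproximated W) {g : X → W} (hg : 1 ≤ ⨆ x, g x) :
    ∃ 𝔵 : Ultrafilter X, ∀ u, TotallyBelow u 1 → {x | u ≤ g x} ∈ 𝔵 := by
  obtain ⟨⟨w, hw⟩, hd, -⟩ := happ
  let F : {u : W // TotallyBelow u 1} → Filter X := fun u => Filter.principal {x | u ≤ g x}
  -- An empty infimum would be `⊤`, which is not proper when `X` is empty.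
  have : Nonempty {u : W // TotallyBelow u 1} := ⟨⟨w, hw⟩⟩
  have hne : (⨅ u, F u).NeBot := by
    refine Filter.iInf_neBot_of_directed' ?_ fun u =>
      Filter.principal_neBot_iff.2 (u.2.exists_le_of_le_iSup hg)
    intro u v
    obtain ⟨z, hz, huz, hvz⟩ := hd u u.2 v v.2
    exact ⟨⟨z, hz⟩, Filter.principal_mono.2 fun x hx => huz.trans hx,
      Filter.principal_mono.2 fun x hx => hvz.trans hx⟩
  exact ⟨Ultrafilter.of _, fun u hu => Ultrafilter.of_le (⨅ u, F u)
    (Filter.mem_iInf_of_mem (⟨u, hu⟩ : {u : W // TotallyBelow u 1}) (Filter.mem_principal_self _))⟩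

theorem le_of_forall_totallyBelow_mul_le (happ : IsApproximated V) {b c : V}
    (h : ∀ u, TotallyBelow u 1 → b * u ≤ c) : b ≤ c := by
  calc b = b * sSup {u : V | TotallyBelow u 1} := by rw [happ.2.2, mul_one]
    _ = ⨆ u ∈ {u : V | TotallyBelow u 1}, b * u := mul_sSup_distrib
    _ ≤ c := iSup₂_le h

/-- Each set of the image ultrafilter contains some `r x` with `u ≤ g x`, so its join is above `b ⊗
u`; joining over `u ≪ k` gives `b`. -/
theorem le_canonicalXi_map (happ : IsApproximated V) {𝔵 : Ultrafilter X} {b : V} {g r : X → V}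
    (hg : ∀ u, TotallyBelow u 1 → {x | u ≤ g x} ∈ 𝔵) (hr : ∀ x, b * g x ≤ r x) :
    b ≤ canonicalXi (𝔵.map r) := by
  refine le_iInf₂ fun S hS => le_of_forall_totallyBelow_mul_le happ fun u hu => ?_
  obtain ⟨x, hxS, hxu⟩ := 𝔵.nonempty_of_mem (Filter.inter_mem (Ultrafilter.mem_map.1 hS) (hg u hu))
  exact ((mul_le_mul' le_rfl hxu).trans (hr x)).trans (le_iSup₂_of_le (r x) hxS le_rfl)

/-- The limit of an ultrafilter along which `φ` and `ψ` tend to the top element represents the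
Cauchy pair `φ`, `ψ`. -/
theorem VCompHaus.isCauchyComplete (hterm : IsTop (1 : V)) (happ : IsApproximated V)
    (A : VCompHaus (canonicalXi (V := V)) X) : A.toVCat.IsCauchyComplete := by
  refine A.toVCat.isCauchyComplete_of_isCauchyPair fun φ ψ h => ?_
  obtain ⟨𝔵, h𝔵⟩ := happ.exists_ultrafilter h.one_le_iSup
  -- Here `k = ⊤` enters: a tensor lies below each of its factors.
  have hle_left (x) : φ x * ψ x ≤ φ x := mul_le_of_le_one_right' (hterm _)
  have hle_right (x) : φ x * ψ x ≤ ψ x := mul_le_of_le_one_left' (hterm _)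
  have hψ (z : X) : ψ z ≤ A.toVCat.hom z (A.conv 𝔵) :=
    calc ψ z ≤ canonicalXi (𝔵.map (A.toVCat.hom z)) :=
          le_canonicalXi_map happ h𝔵 fun x =>
            (mul_le_mul' le_rfl (hle_left x)).trans (h.mul_le_hom z x)
      _ ≤ A.toVCat.hom (A.conv (pure z)) (A.conv 𝔵) :=
          (le_ultraExt_pure_left _ _ z 𝔵).trans (A.isVFunctor _ _)
      _ = _ := by rw [A.isAlgebra.unit]
  have hφ (z : X) : φ z ≤ A.toVCat.hom (A.conv 𝔵) z :=
    calc φ z ≤ canonicalXi (𝔵.map fun x => A.toVCat.hom x z) :=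
          le_canonicalXi_map happ h𝔵 fun x =>
            (mul_comm _ _).le.trans <|
              (mul_le_mul' (hle_right x) le_rfl).trans (h.mul_le_hom x z)
      _ ≤ A.toVCat.hom (A.conv 𝔵) (A.conv (pure z)) :=
          (le_ultraExt_pure_right _ _ z 𝔵).trans (A.isVFunctor _ _)
      _ = _ := by rw [A.isAlgebra.unit]
  exact ⟨A.conv 𝔵,
    -- With `x₀` the limit, `φ z ⊗ ψ z ≤ φ z ⊗ a(z, x₀) ≤ φ x₀`; the next line is dual.
    h.one_le_iSup.trans (iSup_le fun z => (mul_le_mul' le_rfl (hψ z)).trans (h.mul_hom_le _ _)),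
    h.one_le_iSup.trans (iSup_le fun z => (mul_le_mul' (hφ z) le_rfl).trans (h.hom_mul_le _ _))⟩

/-! ### The L-closure and compact `V`-categories -/

theorem VCat.lClosure_lClosure (A : VCat V X) (M : Set X) :
    A.lClosure (A.lClosure M) = A.lClosure M := by
  refine Set.Subset.antisymm (fun x hx => ?_) (A.subset_lClosure _)
  rw [A.mem_lClosure] at hx ⊢
  refine hx.trans (iSup_le fun z => ?_)
  calc A.hom x z * A.hom z x = A.hom x z * A.hom z x * 1 := (mul_one _).symm
    _ ≤ A.hom x z * A.hom z x * ⨆ w : M, A.hom z w * A.hom w z :=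
        mul_le_mul' le_rfl ((A.mem_lClosure M z).1 z.2)
    _ = ⨆ w : M, A.hom x z * A.hom z x * (A.hom z w * A.hom w z) := Quantale.mul_iSup_distrib
    _ ≤ ⨆ w : M, A.hom x w * A.hom w x := iSup_mono fun w =>
        calc A.hom x z * A.hom z x * (A.hom z w * A.hom w z)
            = (A.hom x z * A.hom z w) * (A.hom w z * A.hom z x) := by
              rw [mul_mul_mul_comm, mul_comm (A.hom w z)]
          _ ≤ _ := mul_le_mul' (A.hom_mul_hom_le _ _ _) (A.hom_mul_hom_le _ _ _)

/-- By idempotence the L-closure is itself a closed set. -/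
theorem VCat.closure_subset_lClosure (hV : IsVeeIrreducible V) (A : VCat V X) (M : Set X) :
    @closure X (A.lTopology hV) M ⊆ A.lClosure M := by
  let := A.lTopology hV
  refine closure_minimal (A.subset_lClosure M) ?_
  rw [← isOpen_compl_iff]
  change (A.lClosure M)ᶜᶜ ∈ {M : Set X | A.lClosure M = M}
  rw [compl_compl]
  exact A.lClosure_lClosure M

theorem VCat.IsCompact.isCauchyComplete (hterm : IsTop (1 : V)) (happ : IsApproximated V)
    {A : VCat V X} (hA : A.IsCompact happ.isVeeIrreducible) : A.IsCauchyComplete := by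
  refine A.isCauchyComplete_of_isCauchyPair fun φ ψ h => ?_
  obtain ⟨𝔵, h𝔵⟩ := happ.exists_ultrafilter h.one_le_iSup
  let := A.lTopology happ.isVeeIrreducible
  have : CompactSpace X := hA
  obtain ⟨x, hx⟩ := exists_clusterPt_of_compactSpace (𝔵 : Filter X)
  have key (u : V) (hu : TotallyBelow u 1) :
      1 ≤ ⨆ z : {x | u ≤ φ x * ψ x}, A.hom x z * A.hom z x := by
    rw [← A.mem_lClosure]
    exact A.closure_subset_lClosure _ _
      (mem_closure_iff_clusterPt.2 (hx.mono (Filter.le_principal_iff.2 (h𝔵 u hu))))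
  -- Applied with `c = φ x` and `c = ψ x`, where `x` is the cluster point.
  have bound (u : V) (hu : TotallyBelow u 1) {c : V}
      (hc : ∀ z, φ z * ψ z * (A.hom x z * A.hom z x) ≤ c) : 1 * u ≤ c :=
    calc 1 * u = u * 1 := mul_comm _ _
      _ ≤ u * ⨆ z : {x | u ≤ φ x * ψ x}, A.hom x z * A.hom z x := mul_le_mul' le_rfl (key u hu)
      _ = ⨆ z : {x | u ≤ φ x * ψ x}, u * (A.hom x z * A.hom z x) := Quantale.mul_iSup_distrib
      _ ≤ c := iSup_le fun z => (mul_le_mul' z.2 le_rfl).trans (hc z)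
  refine ⟨x, le_of_forall_totallyBelow_mul_le happ fun u hu => bound u hu fun z => ?_,
    le_of_forall_totallyBelow_mul_le happ fun u hu => bound u hu fun z => ?_⟩
  -- Discarding factors leaves `φ z ⊗ a(z, x) ≤ φ x`, and below `a(x, z) ⊗ ψ z ≤ ψ x`.
  · exact (mul_le_mul' (mul_le_of_le_one_right' (hterm _))
      (mul_le_of_le_one_left' (hterm _))).trans (h.mul_hom_le z x)
  · exact ((mul_le_mul' (mul_le_of_le_one_left' (hterm _))
      (mul_le_of_le_one_right' (hterm _))).trans (mul_comm _ _).le).trans (h.hom_mul_le x z)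

end VQ

theorem corollaryd {V : Type u} [CompletelyDistribLattice V] [CommMonoid V]
    [IsQuantale V] (ξ : Ultrafilter V → V) (hξ : VQ.IsStrictUltrafilterTheory ξ)
    (hcan : ξ = VQ.canonicalXi) (hterm : IsTop (1 : V)) (happ : VQ.IsApproximated V) :
    (∀ (X : Type v) (A : VQ.VCompHaus ξ X),
      VQ.VCat.IsCauchyComplete.{w} A.toVCat) ∧
    (∀ (X : Type v) (A : VQ.VCat V X),
      A.IsCompact happ.isVeeIrreducible → A.IsSeparated →
        VQ.VCat.IsCauchyComplete.{w} A) := by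
  subst hcan
  exact ⟨fun _ A => A.isCauchyComplete hterm happ,
    fun _ _ hA _ => hA.isCauchyComplete hterm happ⟩
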